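/- In online facility location one is given a finite undirected graph $G=(V,E)$ with nonnegative edge costs and nonnegative facility opening costs $f_v$ ($v\in V$). Clients $r_1,\dots,r_k\in V$ arrive one at a time. When a client arrives, the algorithm may irrevocably open facilities (paying $f_v$ for each newly opened $v$) and then connects the client to its closest open facility, paying the shortest-path distance. In the version with predictions the algorithm is also given, in advance, a set $\hat R\subseteq V$ of predicted clients. $\mathrm{OPT}(R)$ is the minimum cost of an offline solution for the request sequence $R$. An (oblivious) $(n,k,\Delta_1,\Delta_2)$-adversary consists of such a network, a prediction $\hat R$, and a probability distribution over sequences $R$ of requests at distinct vertices, chosen independently of the algorithm's random choices, such that always $|\hat R|=n$, $|R|=k$, $|\hat R\setminus R|=\Delta_1$ and $|R\setminus\hat R|=\Delta_2$. **Theorem.** There is an absolute constant $c>0$ such that for all nonnegative integers $n,k,\Delta_1,\Delta_2$ with $\Delta_1\le n$, $\Delta_2\le k$ and $n-\Delta_1=k-\Delta_2$ there is an oblivious $(n,k,\Delta_1,\Delta_2)$-adversary for facility location with predictions such that, writing $\Delta=\Delta_1+\Delta_2$: if $k\ge 1$, then $\mathrm{OPT}(R)>0$ for every possible $R$; and if $\min(k,\Delta)\ge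 3$, then every randomized online algorithm $\mathrm{ALG}$ (which may depend on the network, the prediction and the distribution of $R$) satisfies $$\mathbb E[\mathrm{ALG}(R)]\;\ge\; c\cdot\frac{\log\min(k,\Delta)}{\log\log\min(k,\Delta)}\cdot\mathbb E[\mathrm{OPT}(R)].$$ That is, every randomized algorithm is $\Omega\!\left(\frac{\log\min(k,\Delta)}{\log\log\min(k,\Delta)}\right)$-competitive against this adversary. -/

import Mathlib

open scoped ENNReal NNReal

namespace FacilityLocation

/-- An offline part of online facility location: an undirected graph on the vertex set `V`,
a nonnegative cost for every edge, and a nonnegative facility opening cost for every vertex. -/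
structure Network (V : Type) where
  graph : SimpleGraph V
  edgeCost : Sym2 V → ℝ≥0
  openingCost : V → ℝ≥0

namespace Network

variable {V : Type}

/-- Total cost of the edges of a walk, counted with multiplicity. -/
def walkCost (N : Network V) {u v : V} (p : N.graph.Walk u v) : ℝ≥0 :=
  (p.edges.map N.edgeCost).sum

/-- Shortest path distance (`∞` if there is no path). -/
noncomputable def dist (N : Network V) (u v : V) : ℝ≥0∞ :=
  ⨅ p : N.graph.Walk u v, (N.walkCost p : ℝ≥0∞)

/-- Distance from a client at `r` to the closest facility of `F` (`∞` if `F` is empty). -/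
noncomputable def connectionCost (N : Network V) (F : Finset V) (r : V) : ℝ≥0∞ :=
  ⨅ u ∈ F, N.dist u r

/-- Total opening cost of a set of facilities. -/
noncomputable def totalOpeningCost (N : Network V) (F : Finset V) : ℝ≥0∞ :=
  ∑ v ∈ F, (N.openingCost v : ℝ≥0∞)

/-- Optimal offline cost of serving the clients in the list `R`. -/
noncomputable def opt (N : Network V) (R : List V) : ℝ≥0∞ :=
  ⨅ F : Finset V, (N.totalOpeningCost F + ∑ i : Fin R.length, N.connectionCost F (R.get i))

end Network

/-- A deterministic online algorithm with predictions. Given the prediction and the list of the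
clients that have arrived so far (the current client is the last entry), it returns the set of
facilities that it opens in this step, before the current client is connected.
It is an algorithm on a fixed network, on which it may depend arbitrarily. -/
def OnlineAlgorithm (V : Type) : Type := Finset V → List V → Finset V

/-- The product sigma-algebra, with every set of facility sets measurable in each coordinate:
generated by the events "on this prediction and history, this set of facilities is opened". -/
instance (V : Type) : MeasurableSpace (OnlineAlgorithm V) :=
  @MeasurableSpace.pi (Finset V) (fun _ => List V → Finset V)
    (fun _ => @MeasurableSpace.pi (List V) (fun _ => Finset V) (fun _ => ⊤))

namespace OnlineAlgorithm

variable {V : Type} [DecidableEq V]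

/-- Facilities that are open once the algorithm has reacted to the first `i` clients of `R`. -/
def openFacilities (A : OnlineAlgorithm V) (P : Finset V) (R : List V) (i : ℕ) : Finset V :=
  (Finset.range i).biUnion fun j => A P (R.take (j + 1))

/-- Cost of the algorithm on prediction `P` and request sequence `R`: each opened facility is
paid for once, and each client is connected to the closest facility open right after the
algorithm's reaction to its arrival. -/
noncomputable def cost (A : OnlineAlgorithm V) (N : Network V) (P : Finset V) (R : List V) :
    ℝ≥0∞ :=
  N.totalOpeningCost (A.openFacilities P R R.length) +
    ∑ i : Fin R.length, N.connectionCost (A.openFacilities P R (i + 1)) (R.get i)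

end OnlineAlgorithm

/-- An oblivious `(n, k, Δ₁, Δ₂)`-adversary on the vertex set `V`: a network, a prediction, and a
probability distribution over request sequences, chosen independently of the algorithm's
randomness. Requests are at distinct vertices, so that the sequence is a set of `k` clients. -/
structure Adversary (V : Type) [DecidableEq V] (n k Δ₁ Δ₂ : ℕ) where
  network : Network V
  prediction : Finset V
  requests : PMF (List V)
  card_prediction : prediction.card = n
  nodup_requests : ∀ R ∈ requests.support, R.Nodup
  length_requests : ∀ R ∈ requests.support, R.length = k
  card_prediction_sdiff : ∀ R ∈ requests.support, (prediction \ R.toFinset).card = Δ₁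
  card_requests_sdiff : ∀ R ∈ requests.support, (R.toFinset \ prediction).card = Δ₂

namespace Adversary

variable {V : Type} [DecidableEq V] {n k Δ₁ Δ₂ : ℕ}

/-- Expected optimal offline cost. -/
noncomputable def expectedOpt (adv : Adversary V n k Δ₁ Δ₂) : ℝ≥0∞ :=
  ∑' R : List V, adv.requests R * adv.network.opt R

/-- Expected cost of the randomized algorithm given by the distribution `μ` over deterministic
online algorithms, over the independent random choices of the algorithm and the adversary. -/
noncomputable def expectedCost (adv : Adversary V n k Δ₁ Δ₂)
    (μ : MeasureTheory.Measure (OnlineAlgorithm V)) : ℝ≥0∞ :=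
  ∑' R : List V, adv.requests R * ∫⁻ A, A.cost adv.network adv.prediction R ∂μ

end Adversary

end FacilityLocation

namespace FacilityLocation

/-! By Yao's principle it suffices to bound deterministic algorithms on a random input. Points are
the binary words of length `h`, with words first differing in position `j` at distance `b⁻ʲ`. A
uniform hidden word `x` is revealed letter by letter: phase `i` brings `b^i (b-1)` clients at the
first `i` letters of `x`, padded with `false`; any remaining clients are fillers at the zero word.
Facilities at `x` and at the zero word serve each phase for at most `b-1`, so OPT is at most `2f +
h(b-1)`.

Online, the letter `x i` is unknown throughout phase `i`. A facility extending the current prefix is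
on the wrong side for `x` or for its flip at `i`, wasting `f`; without such a facility the phase
costs `b(b-1)` under both words. With `f = 2b(b-1)`, each phase `i ≥ 1` costs at least `b(b-1)` on
average (`le_phaseCost_add_phaseCost_update`), and these charges add up (`sum_phaseCost_le_cost`).
For `b = h` the ratio is at least `(h-1)/5`, and `exists_depth` supplies `h` of order `log L / log
log L`, where `L = min(k, Δ)`.

The prediction is fixed before `x` is drawn, so it reveals nothing; it only has to meet the same
cardinalities for every `x`. -/

open Finset

/-! ### Networks realizing a given metric -/

section Metric

variable {V : Type}

/-- The complete graph on `V` with edge costs `d` and uniform opening cost `f`. -/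
def metricNetwork (d : V → V → ℝ≥0) (hd : ∀ u v, d u v = d v u) (f : ℝ≥0) : Network V where
  graph := ⊤
  edgeCost := Sym2.lift ⟨d, hd⟩
  openingCost := fun _ => f

theorem metricNetwork_le_walkCost {d : V → V → ℝ≥0} {hd : ∀ u v, d u v = d v u} {f : ℝ≥0}
    (h0 : ∀ u, d u u = 0) (htri : ∀ u v w, d u w ≤ d u v + d v w) {u v : V}
    (p : (metricNetwork d hd f).graph.Walk u v) :
    d u v ≤ (metricNetwork d hd f).walkCost p := by
  induction p with
  | nil => simp [h0]
  | @cons a b c hab p ih =>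
    refine (htri a b c).trans ?_
    simp only [Network.walkCost, SimpleGraph.Walk.edges_cons, List.map_cons, List.sum_cons] at ih ⊢
    exact add_le_add le_rfl ih

theorem metricNetwork_dist {d : V → V → ℝ≥0} {hd : ∀ u v, d u v = d v u} {f : ℝ≥0}
    (h0 : ∀ u, d u u = 0) (htri : ∀ u v w, d u w ≤ d u v + d v w) (u v : V) :
    (metricNetwork d hd f).dist u v = d u v := by
  refine le_antisymm ?_ (le_iInf fun p => by exact_mod_cast metricNetwork_le_walkCost h0 htri p)
  by_cases huv : u = v
  · subst huv
    exact (iInf_le _ SimpleGraph.Walk.nil).trans (by simp [Network.walkCost])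
  · have hadj : (metricNetwork d hd f).graph.Adj u v := huv
    refine (iInf_le _ (SimpleGraph.Walk.cons hadj SimpleGraph.Walk.nil)).trans ?_
    rw [Network.walkCost, SimpleGraph.Walk.edges_cons, SimpleGraph.Walk.edges_nil]
    simp [metricNetwork]

theorem metricNetwork_totalOpeningCost (d : V → V → ℝ≥0) (hd : ∀ u v, d u v = d v u) (f : ℝ≥0)
    (F : Finset V) : (metricNetwork d hd f).totalOpeningCost F = #F * (f : ℝ≥0∞) := by
  simp [Network.totalOpeningCost, metricNetwork]

theorem metricNetwork_opt_pos (d : V → V → ℝ≥0) (hd : ∀ u v, d u v = d v u) {f : ℝ≥0}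
    (hf : 0 < f) {R : List V} (hR : R ≠ []) : 0 < (metricNetwork d hd f).opt R := by
  have hlen : 0 < R.length := List.length_pos_iff.2 hR
  refine lt_of_lt_of_le (ENNReal.coe_pos.2 hf) (le_iInf fun F => ?_)
  rcases F.eq_empty_or_nonempty with rfl | hF
  · have : (⊤ : ℝ≥0∞) ≤ ∑ i : Fin R.length,
        (metricNetwork d hd f).connectionCost ∅ (R.get i) := by
      refine le_trans ?_ (Finset.single_le_sum (fun _ _ => zero_le)
        (Finset.mem_univ (⟨0, hlen⟩ : Fin R.length)))
      simp [Network.connectionCost]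
    exact (le_top.trans this).trans le_add_self
  · refine le_trans ?_ le_self_add
    rw [metricNetwork_totalOpeningCost]
    exact le_mul_of_one_le_left' (by exact_mod_cast hF.card_pos)

end Metric

/-! ### Monotonicity and measurability of the online cost -/

section Algorithm

variable {V : Type}

theorem Network.connectionCost_anti (N : Network V) {F G : Finset V} (h : F ⊆ G) (r : V) :
    N.connectionCost G r ≤ N.connectionCost F r :=
  biInf_mono fun _ hu => h hu

variable [DecidableEq V]

theorem OnlineAlgorithm.openFacilities_mono (A : OnlineAlgorithm V) (P : Finset V) (R : List V) :
    Monotone (A.openFacilities P R) := fun _ _ h =>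
  Finset.biUnion_subset_biUnion_of_subset_left _ (Finset.range_mono h)

theorem OnlineAlgorithm.opt_le_cost (A : OnlineAlgorithm V) (N : Network V) (P : Finset V)
    (R : List V) : N.opt R ≤ A.cost N P R :=
  (iInf_le _ (A.openFacilities P R R.length)).trans <| add_le_add le_rfl <|
    Finset.sum_le_sum fun i _ => N.connectionCost_anti (A.openFacilities_mono P R i.2) _

/-- The cost depends on `A` only through its `R.length` answers along `R`, so it factors through a
countable discrete space. -/
theorem OnlineAlgorithm.measurable_cost [Finite V] (N : Network V) (P : Finset V) (R : List V) :
    Measurable fun A : OnlineAlgorithm V => A.cost N P R := by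
  let _ : MeasurableSpace (Finset V) := ⊤
  have : MeasurableSingletonClass (Finset V) := ⟨fun _ => trivial⟩
  let ψ : OnlineAlgorithm V → Fin R.length → Finset V := fun A j => A P (R.take (j + 1))
  have hψ : Measurable ψ := measurable_pi_lambda _ fun j =>
    (measurable_pi_apply (R.take (j + 1))).comp
      (measurable_pi_apply (X := fun _ : Finset V => List V → Finset V) P)
  let F : (Fin R.length → Finset V) → ℕ → Finset V := fun φ i =>
    (Finset.range i).biUnion fun j => if h : j < R.length then φ ⟨j, h⟩ else ∅
  let g : (Fin R.length → Finset V) → ℝ≥0∞ := fun φ =>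
    N.totalOpeningCost (F φ R.length) +
      ∑ i : Fin R.length, N.connectionCost (F φ (i + 1)) (R.get i)
  have hF : ∀ A : OnlineAlgorithm V, ∀ i ≤ R.length, A.openFacilities P R i = F (ψ A) i := by
    intro A i hi
    refine Finset.biUnion_congr rfl fun j hj => ?_
    have : j < R.length := (Finset.mem_range.1 hj).trans_le hi
    simp [ψ, this]
  have hg : (fun A : OnlineAlgorithm V => A.cost N P R) = g ∘ ψ := by
    funext A
    simp only [OnlineAlgorithm.cost, Function.comp, g]
    rw [hF A _ le_rfl]
    congr 1
    exact Finset.sum_congr rfl fun i _ => by rw [hF A _ i.2]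
  rw [hg]
  exact (measurable_of_countable g).comp hψ

end Algorithm

/-! ### Yao's principle -/

section Expectation

theorem tsum_map_mul {α β : Type} (p : PMF α) (g : α → β) (F : β → ℝ≥0∞) :
    ∑' R, p.map g R * F R = ∑' x, p x * F (g x) := by
  classical
  simp only [PMF.map_apply, ← ENNReal.tsum_mul_right]
  rw [ENNReal.tsum_comm]
  refine tsum_congr fun x => ?_
  rw [tsum_eq_single (g x)]
  · simp
  · intro b hb
    simp [hb]

variable {V : Type} [DecidableEq V] {n k Δ₁ Δ₂ : ℕ}

theorem Adversary.le_expectedCost [Finite V] (adv : Adversary V n k Δ₁ Δ₂) {C : ℝ≥0∞}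
    (hC : ∀ A : OnlineAlgorithm V,
      C ≤ ∑' R, adv.requests R * A.cost adv.network adv.prediction R)
    (μ : MeasureTheory.Measure (OnlineAlgorithm V)) [MeasureTheory.IsProbabilityMeasure μ] :
    C ≤ adv.expectedCost μ := by
  have hm := fun R : List V =>
    OnlineAlgorithm.measurable_cost adv.network adv.prediction R
  have h1 : adv.expectedCost μ =
      ∫⁻ A, ∑' R, adv.requests R * A.cost adv.network adv.prediction R ∂μ := by
    have := Finite.to_countable (α := V)
    rw [MeasureTheory.lintegral_tsum fun R => ((hm R).const_mul _).aemeasurable]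
    exact tsum_congr fun R => (MeasureTheory.lintegral_const_mul _ (hm R)).symm
  rw [h1]
  calc C = ∫⁻ _, C ∂μ := by simp
    _ ≤ _ := MeasureTheory.lintegral_mono hC

theorem Adversary.expectedOpt_le_expectedCost [Finite V] (adv : Adversary V n k Δ₁ Δ₂)
    (μ : MeasureTheory.Measure (OnlineAlgorithm V)) [MeasureTheory.IsProbabilityMeasure μ] :
    adv.expectedOpt ≤ adv.expectedCost μ :=
  adv.le_expectedCost (fun A => ENNReal.tsum_le_tsum fun R => by
    gcongr; exact A.opt_le_cost _ _ _) μ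

end Expectation

/-! ### The tree metric on words and the request pattern -/

section Words

variable {h : ℕ} (b : ℕ)

/-- The hierarchically separated distance on binary words of length `h`: words that first differ
in position `j` have distance `b⁻ʲ`. -/
noncomputable def wordDist (x y : Fin h → Bool) : ℝ≥0 :=
  univ.sup fun j : Fin h => if x j = y j then 0 else ((b : ℝ≥0)⁻¹) ^ (j : ℕ)

theorem wordDist_self (x : Fin h → Bool) : wordDist b x x = 0 := by
  simp [wordDist]

theorem wordDist_comm (x y : Fin h → Bool) : wordDist b x y = wordDist b y x := by
  simp only [wordDist, eq_comm]

theorem le_wordDist {x y : Fin h → Bool} {j : Fin h} (hj : x j ≠ y j) :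
    ((b : ℝ≥0)⁻¹) ^ (j : ℕ) ≤ wordDist b x y := by
  refine le_trans ?_ (Finset.le_sup (mem_univ j))
  simp [hj]

theorem wordDist_triangle (x y z : Fin h → Bool) :
    wordDist b x z ≤ wordDist b x y + wordDist b y z := by
  refine Finset.sup_le fun j _ => ?_
  split_ifs with hxz
  · exact zero_le
  · by_cases hxy : x j = y j
    · exact (le_wordDist b (hxy ▸ hxz)).trans le_add_self
    · exact (le_wordDist b hxy).trans le_self_add

variable {b}

theorem inv_natCast_le_one (hb : 2 ≤ b) : (b : ℝ≥0)⁻¹ ≤ 1 :=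
  inv_le_one_of_one_le₀ (by exact_mod_cast (by omega : 1 ≤ b))

theorem wordDist_le (hb : 2 ≤ b) {x y : Fin h → Bool} {i : ℕ}
    (hxy : ∀ j : Fin h, (j : ℕ) < i → x j = y j) : wordDist b x y ≤ ((b : ℝ≥0)⁻¹) ^ i := by
  refine Finset.sup_le fun j _ => ?_
  split_ifs with hj
  · exact zero_le
  · exact pow_le_pow_of_le_one zero_le (inv_natCast_le_one hb) (not_lt.1 fun hlt => hj (hxy j hlt))

variable (b)

/-- The word at which the client number `t` arrives if the hidden word is `x`: the first `i`
letters of `x`, where `b ^ i ≤ t + 1 < b ^ (i + 1)`. Clients after the first `b ^ h - 1` arrive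
at the zero word. -/
def requestWord (x : Fin h → Bool) (t : ℕ) : Fin h → Bool := fun j =>
  if b ^ ((j : ℕ) + 1) ≤ t + 1 ∧ t + 1 < b ^ h then x j else false

variable {b}

/-- Letter `i` stays hidden until phase `i + 1`, so the clients through phase `i` do not distinguish
a word from its flip at `i`. -/
theorem requestWord_update (x : Fin h → Bool) (i : Fin h) (a : Bool) {t : ℕ}
    (ht : t + 1 < b ^ ((i : ℕ) + 1)) :
    requestWord b (Function.update x i a) t = requestWord b x t := by
  funext j
  unfold requestWord
  by_cases hj : j = i
  · subst hj
    simp [not_le.2 ht]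
  · simp [Function.update_of_ne hj]

end Words

/-! ### The hard instance and its predictions -/

section Instance

variable {h : ℕ} (b k n : ℕ)

/-- The vertices of the hard instance: `k + n` copies of every word. -/
abbrev Vertex (h k n : ℕ) : Type := (Fin h → Bool) × Fin (k + n)

/-- The vertex of the client number `t` if the hidden word is `x`. -/
def request (x : Fin h → Bool) (t : Fin k) : Vertex h k n :=
  (requestWord b x t, Fin.castAdd n t)

theorem request_injective (x : Fin h → Bool) : Function.Injective (request b k n x) :=
  fun _ _ hst => Fin.castAdd_injective k n (congrArg Prod.snd hst)

/-- The request sequence for the hidden word `x`. -/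
def requestList (x : Fin h → Bool) : List (Vertex h k n) := List.ofFn (request b k n x)

/-- The network of the hard instance. -/
noncomputable def hardNetwork (h b k n : ℕ) (f : ℝ≥0) : Network (Vertex h k n) :=
  metricNetwork (fun u v => wordDist b u.1 v.1) (fun _ _ => wordDist_comm b _ _) f

theorem hardNetwork_dist (f : ℝ≥0) (u v : Vertex h k n) :
    (hardNetwork h b k n f).dist u v = wordDist b u.1 v.1 :=
  metricNetwork_dist (d := fun u v : Vertex h k n => wordDist b u.1 v.1)
    (fun _ => wordDist_self b _) (fun _ _ _ => wordDist_triangle b _ _ _) u v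

theorem card_sdiff_of_request {ι W : Type} [Fintype ι] [DecidableEq W] {r : ι → W}
    (hr : Function.Injective r) (P : Finset W) (Q : Finset W) (hQ : ∀ w, w ∈ Q ↔ ∃ t, r t = w) :
    #(P \ Q) + #{t | r t ∈ P} = #P ∧ #(Q \ P) + #{t | r t ∈ P} = Fintype.card ι := by
  obtain rfl : Q = univ.map ⟨r, hr⟩ := by ext w; simp [hQ]
  have h1 : #{t | r t ∈ P} = #(P ∩ univ.map ⟨r, hr⟩) := by
    rw [← card_map ⟨r, hr⟩]
    congr 1
    ext w
    simp only [mem_map, mem_filter, mem_univ, true_and, Function.Embedding.coeFn_mk, mem_inter]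
    constructor
    · rintro ⟨t, ht, rfl⟩; exact ⟨ht, t, rfl⟩
    · rintro ⟨hw, t, rfl⟩; exact ⟨t, hw, rfl⟩
  refine ⟨by rw [h1, card_sdiff_add_card_inter], ?_⟩
  rw [h1, inter_comm, card_sdiff_add_card_inter, card_map, card_univ]

/-- The hard instance with a prediction `P` that contains, for every hidden word, the same number
of clients. -/
noncomputable def hardAdversary {Δ₁ Δ₂ : ℕ} (f : ℝ≥0) (P : Finset (Vertex h k n)) {m : ℕ}
    (hP : #P = n) (hn : n = m + Δ₁) (hk : k = m + Δ₂)
    (hm : ∀ x : Fin h → Bool, #{t | request b k n x t ∈ P} = m) :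
    Adversary (Vertex h k n) n k Δ₁ Δ₂ where
  network := hardNetwork h b k n f
  prediction := P
  requests := (PMF.uniformOfFintype (Fin h → Bool)).map (requestList b k n)
  card_prediction := hP
  nodup_requests R hR := by
    obtain ⟨x, -, rfl⟩ := (PMF.mem_support_map_iff _ _ _).1 hR
    exact List.nodup_ofFn.2 (request_injective b k n x)
  length_requests R hR := by
    obtain ⟨x, -, rfl⟩ := (PMF.mem_support_map_iff _ _ _).1 hR
    exact List.length_ofFn
  card_prediction_sdiff R hR := by
    obtain ⟨x, -, rfl⟩ := (PMF.mem_support_map_iff _ _ _).1 hR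
    have := (card_sdiff_of_request (request_injective b k n x) P
      (requestList b k n x).toFinset (by simp [requestList])).1
    rw [hm, hP] at this
    omega
  card_requests_sdiff R hR := by
    obtain ⟨x, -, rfl⟩ := (PMF.mem_support_map_iff _ _ _).1 hR
    have := (card_sdiff_of_request (request_injective b k n x) P
      (requestList b k n x).toFinset (by simp [requestList])).2
    rw [hm, Fintype.card_fin] at this
    omega

theorem card_filter_fin (N : ℕ) (p : ℕ → Prop) [DecidablePred p] :
    #{t : Fin N | p t} = #{t ∈ range N | p t} := by
  rw [← card_map Fin.valEmbedding]
  congr 1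
  ext t
  simp only [mem_map, mem_filter, mem_univ, true_and, Fin.valEmbedding_apply, mem_range]
  constructor
  · rintro ⟨s, hs, rfl⟩; exact ⟨s.2, hs⟩
  · rintro ⟨ht, hp⟩; exact ⟨⟨t, ht⟩, hp, rfl⟩

theorem card_filter_fin_Ico {N i j : ℕ} (hj : j ≤ N) :
    #{t : Fin N | i ≤ t ∧ (t : ℕ) < j} = j - i := by
  rw [card_filter_fin N fun t => i ≤ t ∧ t < j, ← Nat.card_Ico]
  congr 1
  ext t
  simp only [mem_filter, mem_range, mem_Ico]
  omega

/-- With `Δ₂` large, all informative clients can go unpredicted: the predicted copies of the zero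
word meet the requests exactly in the fillers numbered from `Δ₂` on. -/
theorem exists_prediction_of_le {Δ₁ Δ₂ m : ℕ} (hn : n = m + Δ₁) (hk : k = m + Δ₂)
    (hS : b ^ h ≤ Δ₂ + 1) :
    ∃ P : Finset (Vertex h k n), #P = n ∧
      ∀ x : Fin h → Bool, #{t | request b k n x t ∈ P} = m := by
  let B : Finset (Fin (k + n)) := {t | Δ₂ ≤ (t : ℕ) ∧ (t : ℕ) < Δ₂ + n}
  refine ⟨{fun _ => false} ×ˢ B, ?_, fun x => ?_⟩
  · rw [card_product, card_filter_fin_Ico (by omega)]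
    simp
  · have : ∀ t : Fin k, request b k n x t ∈
        ({fun _ => false} ×ˢ B : Finset (Vertex h k n)) ↔ Δ₂ ≤ (t : ℕ) ∧ (t : ℕ) < k := by
      intro t
      simp only [request, B, mem_product, mem_singleton, mem_filter, mem_univ, true_and,
        Fin.val_castAdd]
      constructor
      · intro ht; omega
      · intro ht
        refine ⟨funext fun j => if_neg fun hj => ?_, by omega⟩
        omega
    rw [filter_congr fun t _ => this t, card_filter_fin_Ico le_rfl]
    omega

/-- With `Δ₁` large, the first `b ^ h - 1` clients can be predicted at every possible word, exactly
one of which is right for each client. -/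
theorem exists_prediction_of_ge {Δ₁ Δ₂ m : ℕ} (hb : 0 < b) (hn : n = m + Δ₁) (hk : k = m + Δ₂)
    (hm : b ^ h ≤ m) (hΔ : b ^ h * 2 ^ h ≤ Δ₁) :
    ∃ P : Finset (Vertex h k n), #P = n ∧
      ∀ x : Fin h → Bool, #{t | request b k n x t ∈ P} = m := by
  obtain ⟨S, hS⟩ : ∃ S, b ^ h = S + 1 := Nat.exists_eq_succ_of_ne_zero (pow_pos hb h).ne'
  obtain ⟨e, he⟩ : ∃ e, Δ₁ + S = 2 ^ h * S + e := by
    refine ⟨Δ₁ + S - 2 ^ h * S, ?_⟩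
    have : 2 ^ h * S ≤ b ^ h * 2 ^ h := by rw [hS]; nlinarith [Nat.zero_le (2 ^ h)]
    omega
  have hone : 1 ≤ 2 ^ h := Nat.one_le_two_pow
  have heΔ : e ≤ Δ₁ := by nlinarith
  let A : Finset (Fin (k + n)) := {t | 0 ≤ (t : ℕ) ∧ (t : ℕ) < S}
  let B : Finset (Fin (k + n)) := {t | S ≤ (t : ℕ) ∧ (t : ℕ) < m}
  -- Copies numbered from `k` on are never requested; they pad the prediction to size `n`.
  let C : Finset (Fin (k + n)) := {t | k ≤ (t : ℕ) ∧ (t : ℕ) < k + e}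
  have hBC : Disjoint B C := disjoint_left.2 fun t ht hc => by
    simp only [B, C, mem_filter, mem_univ, true_and] at ht hc
    omega
  have hABC : Disjoint ((univ : Finset (Fin h → Bool)) ×ˢ A)
      ({fun _ => false} ×ˢ (B.disjUnion C hBC)) := disjoint_left.2 fun t ht hc => by
    simp only [A, B, C, mem_product, mem_disjUnion, mem_filter, mem_univ, true_and] at ht hc
    omega
  refine ⟨disjUnion _ _ hABC, ?_, fun x => ?_⟩
  · rw [card_disjUnion, card_product, card_product, card_disjUnion,
      card_filter_fin_Ico (by omega), card_filter_fin_Ico (by omega),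
      card_filter_fin_Ico (by omega)]
    simp
    omega
  · have : ∀ t : Fin k, request b k n x t ∈ disjUnion _ _ hABC ↔
        0 ≤ (t : ℕ) ∧ (t : ℕ) < m := by
      intro t
      have ht := t.2
      simp only [request, mem_disjUnion, mem_product, mem_singleton, mem_filter, mem_univ,
        true_and, Fin.val_castAdd, A, B, C]
      constructor
      · intro ht; omega
      · intro htm
        rcases lt_or_ge (t : ℕ) S with h' | h'
        · exact Or.inl (by omega)
        · refine Or.inr ⟨funext fun j => if_neg fun hj => ?_, by omega⟩
          omega
    rw [filter_congr fun t _ => this t, card_filter_fin_Ico (by omega)]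
    omega

end Instance

/-! ### Cost of the algorithm and of the optimum, phase by phase -/

section Phases

variable {h b k n : ℕ}

theorem log_succ_eq_iff (hb : 2 ≤ b) {t i : ℕ} :
    Nat.log b (t + 1) = i ↔ b ^ i ≤ t + 1 ∧ t + 1 < b ^ (i + 1) :=
  Nat.log_eq_iff (Or.inr ⟨hb, Nat.succ_ne_zero t⟩)

theorem card_filter_log (hb : 2 ≤ b) {i : ℕ} (hi : b ^ (i + 1) ≤ k + 1) :
    #{t : Fin k | Nat.log b (t + 1) = i} = b ^ i * (b - 1) := by
  have hpos : 0 < b ^ i := pow_pos (by omega) i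
  have hpos' : 0 < b ^ (i + 1) := pow_pos (by omega) _
  have : ∀ t : Fin k, Nat.log b (t + 1) = i ↔ b ^ i - 1 ≤ t ∧ (t : ℕ) < b ^ (i + 1) - 1 := by
    intro t
    rw [log_succ_eq_iff hb]
    omega
  rw [filter_congr fun t _ => this t, card_filter_fin_Ico (by omega), Nat.mul_sub, ← pow_succ]
  omega

theorem sum_requestList {M : Type} [AddCommMonoid M] (x : Fin h → Bool)
    (g : ℕ → Vertex h k n → M) :
    ∑ i : Fin (requestList b k n x).length, g i ((requestList b k n x).get i) =
      ∑ t : Fin k, g t (request b k n x t) :=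
  Fintype.sum_equiv (finCongr List.length_ofFn) _ _ fun i => by
    simp only [requestList, List.get_ofFn]
    rfl

theorem take_requestList_update (x : Fin h → Bool) (i : Fin h) (a : Bool) {s : ℕ}
    (hs : s < b ^ ((i : ℕ) + 1)) :
    (requestList b k n (Function.update x i a)).take s = (requestList b k n x).take s := by
  refine List.ext_getElem (by simp [requestList]) fun t ht _ => ?_
  have hts : t < s := by
    rw [List.length_take] at ht
    omega
  simp [requestList, request, requestWord_update x i a (by omega : t + 1 < b ^ ((i : ℕ) + 1))]

variable (A : OnlineAlgorithm (Vertex h k n)) (P : Finset (Vertex h k n))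

/-- The facilities that are open when the clients at prefixes of length `i` have arrived. -/
def phaseFacilities (b : ℕ) (x : Fin h → Bool) (i : Fin h) : Finset (Vertex h k n) :=
  A.openFacilities P (requestList b k n x) (b ^ ((i : ℕ) + 1) - 1)

/-- The facilities of phase `i` whose words differ from `x` for the first time in
position `i`. -/
def phaseLost (b : ℕ) (x : Fin h → Bool) (i : Fin h) : Finset (Vertex h k n) :=
  {v ∈ phaseFacilities A P b x i | (∀ j < i, v.1 j = x j) ∧ v.1 i ≠ x i}

/-- The connection cost of the clients at prefixes of length `i`. -/
noncomputable def phaseConnection (b : ℕ) (f : ℝ≥0) (x : Fin h → Bool) (i : Fin h) : ℝ≥0∞ :=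
  ∑ t : Fin k, if Nat.log b (t + 1) = i then
    (hardNetwork h b k n f).connectionCost (A.openFacilities P (requestList b k n x) (t + 1))
      (request b k n x t) else 0

/-- The cost that is charged to phase `i`. -/
noncomputable def phaseCost (b : ℕ) (f : ℝ≥0) (x : Fin h → Bool) (i : Fin h) : ℝ≥0∞ :=
  #(phaseLost A P b x i) * (f : ℝ≥0∞) + phaseConnection A P b f x i

/-- A facility has only one position of first disagreement with `x`, so its opening cost is charged
to at most one phase; likewise each client belongs to one phase. -/
theorem sum_phaseCost_le_cost (hb : 2 ≤ b) (hk : b ^ h ≤ k + 1) (f : ℝ≥0) (x : Fin h → Bool) :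
    ∑ i, phaseCost A P b f x i ≤ A.cost (hardNetwork h b k n f) P (requestList b k n x) := by
  simp only [phaseCost, sum_add_distrib]
  refine add_le_add ?_ ?_
  · have hdisj : (Set.univ : Set (Fin h)).PairwiseDisjoint (phaseLost A P b x) := by
      have key : ∀ i j : Fin h, i < j → Disjoint (phaseLost A P b x i) (phaseLost A P b x j) := by
        refine fun i j hij => disjoint_left.2 fun v hi hj => ?_
        exact (mem_filter.1 hi).2.2 ((mem_filter.1 hj).2.1 i hij)
      intro i _ j _ hij
      rcases lt_or_gt_of_ne hij with hlt | hlt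
      · exact key i j hlt
      · exact (key j i hlt).symm
    rw [hardNetwork, metricNetwork_totalOpeningCost, ← Finset.sum_mul]
    gcongr
    rw [← Nat.cast_sum, ← card_biUnion fun i _ j _ hij => hdisj trivial trivial hij]
    refine Nat.cast_le.2 (card_le_card (biUnion_subset.2 fun i _ => ?_))
    refine (filter_subset _ _).trans (A.openFacilities_mono P _ ?_)
    have : b ^ ((i : ℕ) + 1) ≤ b ^ h := Nat.pow_le_pow_right (by omega) i.2
    simp only [requestList, List.length_ofFn]
    omega
  · rw [sum_requestList x fun t v => (hardNetwork h b k n f).connectionCost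
      (A.openFacilities P (requestList b k n x) (t + 1)) v]
    simp only [phaseConnection]
    rw [sum_comm]
    refine sum_le_sum fun t _ => ?_
    by_cases ht : Nat.log b (t + 1) < h
    · rw [sum_eq_single (⟨_, ht⟩ : Fin h)]
      · simp
      · intro i _ hi
        exact if_neg fun h' => hi (Fin.ext h'.symm)
      · simp
    · rw [sum_eq_zero fun (i : Fin h) _ => if_neg fun h' => ht (h'.trans_lt i.2)]
      exact zero_le

/-- Each of the `b^i (b-1)` clients is at distance at least `b^{-(i-1)}` from every open facility;
the exponent needs `i ≥ 1`. -/
theorem le_phaseConnection (hb : 2 ≤ b) (hk : b ^ h ≤ k + 1) (f : ℝ≥0) (x : Fin h → Bool)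
    (i : Fin h) (hi : 0 < (i : ℕ))
    (hF : ∀ v ∈ phaseFacilities A P b x i, ∃ j < i, v.1 j ≠ x j) :
    ((b * (b - 1 : ℕ) : ℝ≥0) : ℝ≥0∞) ≤ phaseConnection A P b f x i := by
  have hih : b ^ ((i : ℕ) + 1) ≤ b ^ h := Nat.pow_le_pow_right (by omega) i.2
  have hcost : ∀ t ∈ ({t : Fin k | Nat.log b (t + 1) = i} : Finset (Fin k)),
      ((((b : ℝ≥0)⁻¹) ^ ((i : ℕ) - 1) : ℝ≥0) : ℝ≥0∞) ≤
        (hardNetwork h b k n f).connectionCost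
          (A.openFacilities P (requestList b k n x) (t + 1)) (request b k n x t) := by
    intro t ht
    obtain ⟨ht1, ht2⟩ := (log_succ_eq_iff hb).1 (mem_filter.1 ht).2
    refine le_iInf₂ fun u hu => ?_
    obtain ⟨j, hj, hne⟩ := hF u (A.openFacilities_mono P _ (by omega) hu)
    rw [hardNetwork_dist]
    refine ENNReal.coe_le_coe.2 (le_trans ?_ (le_wordDist b (j := j) ?_))
    · exact pow_le_pow_of_le_one zero_le (inv_natCast_le_one hb) (by
        have : (j : ℕ) < i := hj
        omega)
    · have hji : b ^ ((j : ℕ) + 1) ≤ b ^ (i : ℕ) := Nat.pow_le_pow_right (by omega) hj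
      simpa only [request, requestWord, if_pos (And.intro (hji.trans ht1) (ht2.trans_le hih))]
        using hne
  rw [phaseConnection, ← sum_filter]
  refine le_trans ?_ (card_nsmul_le_sum _ _ _ hcost)
  rw [card_filter_log hb (hih.trans hk), nsmul_eq_mul]
  norm_cast
  refine le_of_eq ?_
  obtain ⟨i', hi'⟩ : ∃ i', (i : ℕ) = i' + 1 := Nat.exists_eq_succ_of_ne_zero hi.ne'
  have hb0 : (b : ℝ≥0) ≠ 0 := by exact_mod_cast (by omega : b ≠ 0)
  rw [hi']
  push_cast
  rw [inv_pow]
  field_simp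
  ring

theorem le_phaseCost_add_phaseCost_update (hb : 2 ≤ b) (hk : b ^ h ≤ k + 1) {f : ℝ≥0}
    (hf : f = 2 * (b * (b - 1 : ℕ))) (x : Fin h → Bool) (i : Fin h) (hi : 0 < (i : ℕ)) :
    (f : ℝ≥0∞) ≤ phaseCost A P b f x i + phaseCost A P b f (Function.update x i (!x i)) i := by
  set y := Function.update x i (!x i) with hy
  have hyi : y i = !x i := by simp [hy]
  have hyj : ∀ j < i, y j = x j := fun j hj => by simp [hy, hj.ne]
  -- The algorithm has seen identical histories under `x` and `y` up to the end of phase `i`.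
  have hF : phaseFacilities A P b y i = phaseFacilities A P b x i := by
    have : 0 < b ^ ((i : ℕ) + 1) := pow_pos (by omega) _
    refine biUnion_congr rfl fun j hj => ?_
    rw [mem_range] at hj
    rw [hy, take_requestList_update x i _ (by omega)]
  have hlost : ∀ z : Fin h → Bool, (phaseLost A P b z i).Nonempty →
      (f : ℝ≥0∞) ≤ phaseCost A P b f z i := fun z hz =>
    (le_mul_of_one_le_left' (by exact_mod_cast hz.card_pos)).trans le_self_add
  by_cases hex : ∃ v ∈ phaseFacilities A P b x i, ∀ j < i, v.1 j = x j
  · obtain ⟨v, hv, hvx⟩ := hex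
    by_cases hvi : v.1 i = x i
    · refine (hlost y ⟨v, mem_filter.2 ⟨hF ▸ hv, fun j hj => ?_, ?_⟩⟩).trans le_add_self
      · rw [hvx j hj, hyj j hj]
      · rw [hvi, hyi]
        cases x i <;> simp
    · exact (hlost x ⟨v, mem_filter.2 ⟨hv, hvx, hvi⟩⟩).trans le_self_add
  · push Not at hex
    have hx := le_phaseConnection A P hb hk f x i hi hex
    have hy' := le_phaseConnection A P hb hk f y i hi (by
      rw [hF]
      intro v hv
      obtain ⟨j, hj, hne⟩ := hex v hv
      exact ⟨j, hj, by rwa [hyj j hj]⟩)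
    rw [hf, two_mul, ENNReal.coe_add]
    exact add_le_add (hx.trans le_add_self) (hy'.trans le_add_self)

/-- Flipping letter `i` is an involution on words, so summing the pairwise bound counts every word
twice. -/
theorem le_sum_phaseCost (hb : 2 ≤ b) (hk : b ^ h ≤ k + 1) {f : ℝ≥0}
    (hf : f = 2 * (b * (b - 1 : ℕ))) (i : Fin h) (hi : 0 < (i : ℕ)) :
    (2 ^ h : ℝ≥0∞) * ((b * (b - 1 : ℕ) : ℝ≥0) : ℝ≥0∞) ≤ ∑ x, phaseCost A P b f x i := by
  have hinv : Function.Involutive fun x : Fin h → Bool => Function.update x i (!x i) := by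
    intro x
    simp
  have hsum : ∑ x, phaseCost A P b f (Function.update x i (!x i)) i =
      ∑ x, phaseCost A P b f x i :=
    Fintype.sum_equiv hinv.toPerm _ _ fun x => rfl
  have h2 : 2 * ((2 ^ h : ℝ≥0∞) * ((b * (b - 1 : ℕ) : ℝ≥0) : ℝ≥0∞)) ≤
      2 * ∑ x, phaseCost A P b f x i := by
    calc _ = ∑ _x : Fin h → Bool, (f : ℝ≥0∞) := by
          simp [hf]
          ring
      _ ≤ ∑ x, (phaseCost A P b f x i + phaseCost A P b f (Function.update x i (!x i)) i) :=
          sum_le_sum fun x _ => le_phaseCost_add_phaseCost_update A P hb hk hf x i hi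
      _ = _ := by rw [sum_add_distrib, hsum, two_mul]
  exact (ENNReal.mul_le_mul_iff_right (by simp) (by simp)).1 h2

theorem le_sum_cost (hb : 2 ≤ b) (hk : b ^ h ≤ k + 1) {f : ℝ≥0}
    (hf : f = 2 * (b * (b - 1 : ℕ))) :
    (2 ^ h : ℝ≥0∞) * ((h - 1 : ℕ) * ((b * (b - 1 : ℕ) : ℝ≥0) : ℝ≥0∞)) ≤
      ∑ x, A.cost (hardNetwork h b k n f) P (requestList b k n x) := by
  refine le_trans ?_ (sum_le_sum fun x _ => sum_phaseCost_le_cost A P hb hk f x)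
  rw [sum_comm]
  refine le_trans ?_ (sum_le_sum_of_subset (subset_univ {i : Fin h | 1 ≤ (i : ℕ) ∧ (i : ℕ) < h}))
  refine le_trans ?_ (card_nsmul_le_sum _ _ _ fun i hi =>
    le_sum_phaseCost A P hb hk hf i (mem_filter.1 hi).2.1)
  rw [card_filter_fin_Ico le_rfl, nsmul_eq_mul]
  exact le_of_eq (by ring)

theorem opt_requestList_le (hb : 2 ≤ b) (hk : b ^ h ≤ k + 1) (hk0 : 0 < k) (f : ℝ≥0)
    (x : Fin h → Bool) :
    (hardNetwork h b k n f).opt (requestList b k n x) ≤ 2 * f + h * (b - 1 : ℕ) := by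
  -- The copy index does not affect distances, so any one will do.
  let z : Fin (k + n) := ⟨0, by omega⟩
  refine (iInf_le _ {(x, z), (fun _ => false, z)}).trans (add_le_add ?_ ?_)
  · rw [hardNetwork, metricNetwork_totalOpeningCost]
    gcongr
    exact_mod_cast card_le_two
  · rw [sum_requestList x fun _ v => (hardNetwork h b k n f).connectionCost _ v]
    have hterm : ∀ t : Fin k, (hardNetwork h b k n f).connectionCost
        {(x, z), (fun _ => false, z)} (request b k n x t) ≤
        ∑ i ∈ range h, if Nat.log b (t + 1) = i then
          ((((b : ℝ≥0)⁻¹) ^ i : ℝ≥0) : ℝ≥0∞) else 0 := by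
      intro t
      rw [sum_ite_eq]
      split_ifs with ht
      · refine (iInf₂_le (x, z) (by simp)).trans ?_
        rw [hardNetwork_dist]
        refine ENNReal.coe_le_coe.2 (wordDist_le hb fun j hj => ?_)
        have h1 := ((log_succ_eq_iff hb (t := t)).1 rfl).1
        have h2 : (t : ℕ) + 1 < b ^ h := Nat.lt_pow_of_log_lt hb (mem_range.1 ht)
        exact (if_pos ⟨(Nat.pow_le_pow_right (by omega) hj).trans h1, h2⟩).symm
      · refine (iInf₂_le (fun _ => false, z) (by simp)).trans ?_
        rw [hardNetwork_dist]
        have : requestWord b x t = fun _ => false := funext fun j => if_neg fun hj =>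
          ht (mem_range.2 (Nat.log_lt_of_lt_pow (Nat.succ_ne_zero _) hj.2))
        simp [request, this, wordDist_self]
    refine (sum_le_sum fun t _ => hterm t).trans ?_
    rw [sum_comm]
    have hphase : ∀ i ∈ range h, (∑ t : Fin k, if Nat.log b (t + 1) = i then
        ((((b : ℝ≥0)⁻¹) ^ i : ℝ≥0) : ℝ≥0∞) else 0) = (b - 1 : ℕ) := by
      intro i hi
      have hih : b ^ (i + 1) ≤ b ^ h := Nat.pow_le_pow_right (by omega) (mem_range.1 hi)
      rw [← sum_filter, sum_const, card_filter_log hb (hih.trans hk), nsmul_eq_mul]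
      have hb0 : (b : ℝ≥0) ≠ 0 := by exact_mod_cast (by omega : b ≠ 0)
      norm_cast
      rw [inv_pow]
      push_cast
      field_simp
    rw [sum_congr rfl hphase]
    simp

end Phases

/-! ### Expected costs against the hard adversary -/

section Adversary

variable {h b k n Δ₁ Δ₂ m : ℕ} {f : ℝ≥0} {P : Finset (Vertex h k n)} {hP : #P = n}
  {hn : n = m + Δ₁} {hk : k = m + Δ₂}
  {hm : ∀ x : Fin h → Bool, #{t | request b k n x t ∈ P} = m}

theorem hardAdversary_opt_pos (hf : 0 < f) (hk0 : 1 ≤ k) :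
    ∀ R ∈ (hardAdversary b k n f P hP hn hk hm).requests.support,
      0 < (hardAdversary b k n f P hP hn hk hm).network.opt R := by
  intro R hR
  refine metricNetwork_opt_pos _ _ hf ?_
  have := (hardAdversary b k n f P hP hn hk hm).length_requests R hR
  rintro rfl
  simp at this
  omega

theorem hardAdversary_tsum (F : List (Vertex h k n) → ℝ≥0∞) :
    ∑' R, (hardAdversary b k n f P hP hn hk hm).requests R * F R =
      (2 ^ h : ℝ≥0∞)⁻¹ * ∑ x, F (requestList b k n x) := by
  refine (tsum_map_mul _ _ F).trans ?_
  rw [tsum_fintype, mul_sum]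
  simp

theorem hardAdversary_expectedOpt_le (hb : 2 ≤ b) (hbk : b ^ h ≤ k + 1) (hk0 : 0 < k) :
    (hardAdversary b k n f P hP hn hk hm).expectedOpt ≤ 2 * f + h * (b - 1 : ℕ) := by
  rw [Adversary.expectedOpt, hardAdversary_tsum]
  refine (mul_le_mul_right (sum_le_sum fun x _ => opt_requestList_le hb hbk hk0 f x) _).trans ?_
  rw [sum_const, nsmul_eq_mul, ← mul_assoc]
  simp [ENNReal.inv_mul_cancel]

theorem le_hardAdversary_expectedCost (hb : 2 ≤ b) (hbk : b ^ h ≤ k + 1)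
    (hf : f = 2 * (b * (b - 1 : ℕ)))
    (μ : MeasureTheory.Measure (OnlineAlgorithm (Vertex h k n)))
    [MeasureTheory.IsProbabilityMeasure μ] :
    (h - 1 : ℕ) * ((b * (b - 1 : ℕ) : ℝ≥0) : ℝ≥0∞) ≤
      (hardAdversary b k n f P hP hn hk hm).expectedCost μ := by
  refine Adversary.le_expectedCost _ (fun A => ?_) μ
  rw [hardAdversary_tsum]
  refine le_trans ?_ (mul_le_mul_right (le_sum_cost A P hb hbk hf) _)
  rw [← mul_assoc, ENNReal.inv_mul_cancel (by simp) (by simp), one_mul]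

end Adversary

/-! ### Choice of the depth -/

section Parameters

theorem exists_depth {L : ℕ} (hL : 3 ≤ L) :
    1 / 100 * (Real.log L / Real.log (Real.log L)) ≤ 1 ∨
      ∃ h : ℕ, 2 ≤ h ∧ 2 * (h ^ h * 2 ^ h) ≤ L ∧
        1 / 100 * (Real.log L / Real.log (Real.log L)) * 5 ≤ h - 1 := by
  set x := Real.log L with hx
  have hLpos : (0 : ℝ) < L := by exact_mod_cast (by omega : 0 < L)
  have hx3 : 1.09 ≤ x := by
    have : Real.log 3 ≤ x := Real.log_le_log (by norm_num) (by exact_mod_cast hL)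
    have h3 : (1.09 : ℝ) ≤ Real.log 3 := by
      have := Real.log_three_gt_d9
      linarith
    linarith
  have hlog : 1 - x⁻¹ ≤ Real.log x := Real.one_sub_inv_le_log_of_pos (by linarith)
  have hlog' : 0.08 ≤ Real.log x := by
    refine le_trans ?_ hlog
    have : x⁻¹ ≤ 1.09⁻¹ := inv_anti₀ (by norm_num) hx3
    norm_num at this ⊢
    linarith
  have hlp : 0 < Real.log x := by linarith
  rcases le_or_gt x 4 with h4 | h4
  · left
    rw [one_div_mul_eq_div, div_le_one (by norm_num), div_le_iff₀ hlp]
    linarith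
  · have hlog1 : 1 / 2 ≤ Real.log x := by
      refine le_trans ?_ hlog
      have : x⁻¹ ≤ 4⁻¹ := inv_anti₀ (by norm_num) h4.le
      norm_num at this ⊢
      linarith
    rcases lt_or_ge (x / Real.log x) 8 with h8 | h8
    · left
      linarith
    · right
      -- The depth is `⌊y⌋₊`. Since `2y ≤ x`, the logarithm of `2 (2h)^h` is at most `1 + y log x =
      -- 1 + x/4`, which is below `x` for `x > 4`.
      set y := x / (4 * Real.log x) with hy
      have hyx : x / Real.log x = 4 * y := by
        rw [hy]
        field_simp
      have hy2 : 2 ≤ y := by linarith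
      have h1 : (⌊y⌋₊ : ℝ) ≤ y := Nat.floor_le (by linarith)
      have h2 : y < ⌊y⌋₊ + 1 := Nat.lt_floor_add_one y
      have h3 : 2 ≤ ⌊y⌋₊ := Nat.le_floor (by exact_mod_cast hy2)
      have h3' : (2 : ℝ) ≤ ⌊y⌋₊ := by exact_mod_cast h3
      refine ⟨⌊y⌋₊, h3, ?_, by rw [hyx]; linarith⟩
      have hyl : y * Real.log x = x / 4 := by
        rw [hy]
        field_simp
      have h2x : (⌊y⌋₊ : ℝ) * 2 ≤ x := by nlinarith
      have hmain : Real.log (2 * ((⌊y⌋₊ : ℝ) * 2) ^ ⌊y⌋₊) ≤ Real.log L := by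
        rw [Real.log_mul (by norm_num) (by positivity), Real.log_pow]
        have hl2 : Real.log 2 ≤ 1 := by
          have := Real.log_two_lt_d9
          linarith
        have hl : Real.log ((⌊y⌋₊ : ℝ) * 2) ≤ Real.log x :=
          Real.log_le_log (by linarith) h2x
        have hl0 : 0 ≤ Real.log ((⌊y⌋₊ : ℝ) * 2) := Real.log_nonneg (by linarith)
        have : (⌊y⌋₊ : ℝ) * Real.log ((⌊y⌋₊ : ℝ) * 2) ≤ y * Real.log x := by gcongr
        rw [← hx]
        linarith
      have := (Real.log_le_log_iff (by positivity) hLpos).1 hmain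
      rw [← mul_pow]
      exact_mod_cast this

end Parameters

end FacilityLocation

theorem mainTheorem7 :
    ∃ c : ℝ, 0 < c ∧
      ∀ n k Δ₁ Δ₂ : ℕ, Δ₁ ≤ n → Δ₂ ≤ k → n - Δ₁ = k - Δ₂ →
        ∃ (V : Type) (_ : Fintype V) (_ : DecidableEq V)
          (adv : FacilityLocation.Adversary V n k Δ₁ Δ₂),
          (1 ≤ k → ∀ R ∈ adv.requests.support, 0 < adv.network.opt R) ∧
          (3 ≤ min k (Δ₁ + Δ₂) →
            ∀ μ : MeasureTheory.Measure (FacilityLocation.OnlineAlgorithm V),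
              MeasureTheory.IsProbabilityMeasure μ →
                ENNReal.ofReal
                    (c * (Real.log (min k (Δ₁ + Δ₂) : ℕ) /
                      Real.log (Real.log (min k (Δ₁ + Δ₂) : ℕ)))) * adv.expectedOpt
                  ≤ adv.expectedCost μ) := by
  open FacilityLocation in
  refine ⟨1 / 100, by norm_num, fun n k Δ₁ Δ₂ hΔ₁ hΔ₂ heq => ?_⟩
  obtain ⟨m, hn⟩ : ∃ m, n = m + Δ₁ := ⟨n - Δ₁, by omega⟩
  have hk : k = m + Δ₂ := by omega
  by_cases hhard : 3 ≤ min k (Δ₁ + Δ₂) ∧ ∃ h : ℕ, 2 ≤ h ∧ 2 * (h ^ h * 2 ^ h) ≤ min k (Δ₁ + Δ₂) ∧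
      1 / 100 * (Real.log (min k (Δ₁ + Δ₂) : ℕ) /
        Real.log (Real.log (min k (Δ₁ + Δ₂) : ℕ))) * 5 ≤ h - 1
  · obtain ⟨hL, h, h2, hsize, hratio⟩ := hhard
    have hle : h ^ h ≤ h ^ h * 2 ^ h := Nat.le_mul_of_pos_right _ (by positivity)
    have hpred : ∃ P : Finset (Vertex h k n), P.card = n ∧
        ∀ x : Fin h → Bool, (Finset.univ.filter fun t => request h k n x t ∈ P).card = m := by
      -- If `Δ₂` is small, then `hsize` forces both `m = k - Δ₂` and `Δ₁` to be large.
      by_cases hS : h ^ h ≤ Δ₂ + 1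
      · exact exists_prediction_of_le h k n hn hk hS
      · exact exists_prediction_of_ge h k n (by omega) hn hk (by omega) (by omega)
    obtain ⟨P, hP, hm⟩ := hpred
    have hq : (0 : ℝ≥0) < 2 * (h * (h - 1 : ℕ)) := by
      have h1 : (0 : ℝ≥0) < h := by exact_mod_cast (by omega : 0 < h)
      have h1' : (0 : ℝ≥0) < (h - 1 : ℕ) := by exact_mod_cast (by omega : 0 < h - 1)
      positivity
    refine ⟨Vertex h k n, inferInstance, inferInstance,
      hardAdversary h k n (2 * (h * (h - 1 : ℕ))) P hP hn hk hm,
      hardAdversary_opt_pos hq, fun _ μ hμ => ?_⟩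
    refine le_trans ?_ (le_hardAdversary_expectedCost h2 (by omega) rfl μ)
    refine (mul_le_mul_right (hardAdversary_expectedOpt_le h2 (by omega) (by omega)) _).trans ?_
    have hopt : (2 * ((2 * (h * (h - 1 : ℕ)) : ℝ≥0) : ℝ≥0∞) + h * (h - 1 : ℕ)) =
        5 * ((h * (h - 1 : ℕ) : ℝ≥0) : ℝ≥0∞) := by
      push_cast
      ring
    rw [hopt, ← mul_assoc]
    gcongr
    rw [← ENNReal.ofReal_ofNat 5, ← ENNReal.ofReal_mul' (by norm_num), ← ENNReal.ofReal_natCast]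
    refine ENNReal.ofReal_le_ofReal (hratio.trans ?_)
    rw [Nat.cast_sub (by omega)]
    simp
  -- Whenever a bound is demanded here, the claimed ratio is at most 1, so `OPT ≤ ALG` suffices and
  -- the one-word instance serves.
  · obtain ⟨P, hP, hm⟩ := exists_prediction_of_le (h := 0) 2 k n hn hk (by simp)
    refine ⟨Vertex 0 k n, inferInstance, inferInstance, hardAdversary 2 k n 1 P hP hn hk hm,
      hardAdversary_opt_pos one_pos, fun hL μ hμ => ?_⟩
    have hsmall := (exists_depth hL).resolve_right fun h => hhard ⟨hL, h⟩
    refine le_trans ?_ (Adversary.expectedOpt_le_expectedCost _ μ)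
    exact mul_le_of_le_one_left' (ENNReal.ofReal_le_one.2 hsmall)
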